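/- For $\tau\in\mathbb{C}$ let $H_\tau$ denote the Hermite function of degree $\tau$, $$H_\tau(x)=2^\tau\frac{\Gamma(\frac12)}{\Gamma(\frac{1-\tau}{2})}\,{}_1F_1\!\left(-\frac{\tau}{2},\frac12,x^2\right)+2^\tau x\,\frac{\Gamma(-\frac12)}{\Gamma(-\frac{\tau}{2})}\,{}_1F_1\!\left(\frac{1-\tau}{2},\frac32,x^2\right),$$ where ${}_1F_1(a,b,z)=\sum_{k\ge 0}\frac{(a)_k}{(b)_k}\frac{z^k}{k!}$, $(c)_k=c(c+1)\cdots(c+k-1)$, and $1/\Gamma$ is understood as an entire function (zero at the poles of $\Gamma$). Let $\tau\in\mathbb{C}$ with $\operatorname{Re}(\tau)>-1$. Then, for every integer $n\ge 0$, $$\int_0^\infty x^{2n+\tau}H_\tau(x)e^{-x^2}\,dx=\frac{\sqrt\pi}{2^{2n+1}}\,\frac{\Gamma(2n+\tau+1)}{n!},$$ $$\int_{-\infty}^{\infty}x^{2n}|x|^{\tau}H_\tau(|x|)e^{-x^2}\,dx=\frac{\sqrt\pi}{2^{2n}}\,\frac{\Gamma(2n+\tau+1)}{n!},$$ both integrals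 being absolutely convergent. In particular, $$\Gamma(\tau+1)=\frac{2}{\sqrt\pi}\int_0^\infty x^{\tau}H_\tau(x)e^{-x^2}\,dx\qquad\text{and}\qquad \Gamma(\tau+1)=\frac{1}{\sqrt\pi}\int_{-\infty}^{\infty}|x|^{\tau}H_\tau(|x|)e^{-x^2}\,dx.$$ -/

import Mathlib

/-- Kummer's confluent hypergeometric function
`₁F₁(a, b, z) = ∑ₖ (a)ₖ / ((b)ₖ k!) zᵏ`, where `(c)ₖ = c (c + 1) ⋯ (c + k - 1)`.
It is meant for `b` outside `{0, -1, -2, …}`; the series then converges for all `z`. -/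
noncomputable def kummerF (a b z : ℂ) : ℂ :=
  ∑' k : ℕ, (ascPochhammer ℂ k).eval a / ((ascPochhammer ℂ k).eval b * (k.factorial : ℂ)) * z ^ k

/-- The Hermite function `H_τ(z)` of degree `τ ∈ ℂ`. At a pole of `Γ`, Mathlib's `Complex.Gamma`
takes the value `0`, so that the quotients by `Γ` below vanish there, in accordance with the
usual convention that `1 / Γ` is an entire function. -/
noncomputable def hermiteFunction (τ z : ℂ) : ℂ :=
  2 ^ τ * (Complex.Gamma (1 / 2) / Complex.Gamma ((1 - τ) / 2)) *
      kummerF (-τ / 2) (1 / 2) (z ^ 2) +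
    2 ^ τ * z * (Complex.Gamma (-1 / 2) / Complex.Gamma (-τ / 2)) *
      kummerF ((1 - τ) / 2) (3 / 2) (z ^ 2)

/-! All moments are values of one Mellin transform: for Re s > 0, that of H_τ(x)e^{-x²} at s is
Γ(s)√π 2^{τ-s}/Γ((s-τ+1)/2) (`hermiteMellin`). At s = 2n+τ+1 the denominator is Γ(n+1) = n!. If Re τ
< 0, then H_τ(x)e^{-x²} is 1/Γ(-τ) times ∫ t^{-τ-1}e^{-(x+t)²} dt over t > 0. With w = x+t, its
Mellin transform splits into a beta integral and a Gaussian moment, and the duplication formula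
gives the closed form. The recurrence `hermiteFunction_add_one` then carries convergence and value
to every τ, one unit strip at a time, without analytic continuation. -/

/-! ### Contiguous relations and the three-term recurrence in τ -/

lemma ascPochhammer_succ_eval_left (k : ℕ) (a : ℂ) :
    (ascPochhammer ℂ (k + 1)).eval a = a * (ascPochhammer ℂ k).eval (a + 1) := by
  simp [ascPochhammer_succ_left]

lemma ascPochhammer_eval_shift (k : ℕ) (a : ℂ) :
    a * (ascPochhammer ℂ k).eval (a + 1) = (ascPochhammer ℂ k).eval a * (a + k) := by
  rw [← ascPochhammer_succ_eval_left, ascPochhammer_succ_eval]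

lemma ascPochhammer_eval_ne_zero_of_add_ne_zero {b : ℂ} (hb : ∀ k : ℕ, b + k ≠ 0) (k : ℕ) :
    (ascPochhammer ℂ k).eval b ≠ 0 := by
  induction k with
  | zero => simp
  | succ k ih => rw [ascPochhammer_succ_eval]; exact mul_ne_zero ih (hb k)

/-- The `k`-th term of the series defining `kummerF a b z`. -/
noncomputable def kummerTerm (a b z : ℂ) (k : ℕ) : ℂ :=
  (ascPochhammer ℂ k).eval a / ((ascPochhammer ℂ k).eval b * (k.factorial : ℂ)) * z ^ k

lemma kummerTerm_succ (a b z : ℂ) (k : ℕ) :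
    kummerTerm a b z (k + 1) = (a + k) / ((b + k) * (k + 1)) * z * kummerTerm a b z k := by
  simp only [kummerTerm, ascPochhammer_succ_eval, Nat.factorial_succ, Nat.cast_mul, pow_succ,
    div_eq_mul_inv, mul_inv, Nat.cast_add, Nat.cast_one]
  ring

open Filter Topology in
lemma summable_kummerTerm (a b z : ℂ) : Summable (kummerTerm a b z) := by
  have h1 : Tendsto (fun k : ℕ => (a + k) / (b + k)) atTop (𝓝 1) := by
    simpa using tendsto_add_mul_div_add_mul_atTop_nhds a b (1 : ℂ) (d := 1) one_ne_zero
  have h2 : Tendsto (fun k : ℕ => 1 / ((k : ℂ) + 1)) atTop (𝓝 0) :=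
    tendsto_one_div_add_atTop_nhds_zero_nat
  have h3 : Tendsto (fun k : ℕ => ‖(a + k) / ((b + k) * (k + 1)) * z‖) atTop (𝓝 0) := by
    have := ((h1.mul h2).mul_const z).norm
    rw [mul_zero, zero_mul, norm_zero] at this
    simpa only [div_mul_div_comm, mul_one] using this
  refine summable_of_ratio_norm_eventually_le (r := 1 / 2) (by norm_num) ?_
  filter_upwards [h3.eventually_le_const (show (0 : ℝ) < 1 / 2 by norm_num)] with k hk
  rw [kummerTerm_succ, norm_mul]
  gcongr

lemma hasSum_kummerF (a b z : ℂ) : HasSum (kummerTerm a b z) (kummerF a b z) :=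
  (summable_kummerTerm a b z).hasSum

/-- Termwise, (a+1)_{k+1} - (a)_{k+1} = (k+1)(a+1)_k, and k+1 cancels against the factorial. -/
lemma kummerF_add_one_left_sub {b : ℂ} (hb : ∀ k : ℕ, b + k ≠ 0) (a z : ℂ) :
    kummerF (a + 1) b z - kummerF a b z = z / b * kummerF (a + 1) (b + 1) z := by
  have h := (hasSum_kummerF (a + 1) b z).sub (hasSum_kummerF a b z)
  -- Both series start with 1, so the difference starts at index 1.
  rw [← hasSum_nat_add_iff' 1] at h
  refine HasSum.unique (by simpa [kummerTerm] using h) ?_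
  have h' := (hasSum_kummerF (a + 1) (b + 1) z).mul_left (z / b)
  refine h'.congr_fun fun k => ?_
  have hb0 : b ≠ 0 := by simpa using hb 0
  have hb1 : (ascPochhammer ℂ k).eval (b + 1) ≠ 0 :=
    ascPochhammer_eval_ne_zero_of_add_ne_zero
      (fun j => by have := hb (j + 1); push_cast at this; rwa [add_right_comm, add_assoc]) k
  have hk : (k : ℂ) + 1 ≠ 0 := Nat.cast_add_one_ne_zero k
  have hf : (k.factorial : ℂ) ≠ 0 := by exact_mod_cast k.factorial_ne_zero
  simp only [kummerTerm]
  rw [ascPochhammer_succ_eval_left k a, ascPochhammer_succ_eval k (a + 1),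
    ascPochhammer_succ_eval_left k b, Nat.factorial_succ]
  push_cast
  field_simp
  ring

lemma mul_kummerF_eq {b : ℂ} (hb : ∀ k : ℕ, b + k ≠ 0) (a z : ℂ) :
    b * kummerF a b z = (b - a) * kummerF a (b + 1) z + a * kummerF (a + 1) (b + 1) z := by
  refine ((hasSum_kummerF a b z).mul_left b).unique ?_
  refine (((hasSum_kummerF a (b + 1) z).mul_left (b - a)).add
    ((hasSum_kummerF (a + 1) (b + 1) z).mul_left a)).congr_fun fun k => ?_
  have hb0 : b ≠ 0 := by simpa using hb 0
  have hb1 : (ascPochhammer ℂ k).eval (b + 1) ≠ 0 :=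
    ascPochhammer_eval_ne_zero_of_add_ne_zero
      (fun j => by have := hb (j + 1); push_cast at this; rwa [add_right_comm, add_assoc]) k
  have hbk : (ascPochhammer ℂ k).eval b ≠ 0 := ascPochhammer_eval_ne_zero_of_add_ne_zero hb k
  have hf : (k.factorial : ℂ) ≠ 0 := by exact_mod_cast k.factorial_ne_zero
  have ea := ascPochhammer_eval_shift k a
  have eb := ascPochhammer_eval_shift k b
  simp only [kummerTerm]
  field_simp
  linear_combination (-(ascPochhammer ℂ k).eval b * z ^ k) * ea +
    (ascPochhammer ℂ k).eval a * z ^ k * eb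

lemma Complex.Gamma_one_half_eq_sqrt : Complex.Gamma (1 / 2) = (Real.sqrt Real.pi : ℂ) := by
  rw [← Real.Gamma_one_half_eq, ← Complex.Gamma_ofReal]; norm_num

lemma Complex.Gamma_neg_one_half_eq : Complex.Gamma (-1 / 2) = -2 * (Real.sqrt Real.pi : ℂ) := by
  have h := Complex.Gamma_add_one (-1 / 2) (by norm_num)
  rw [show (-1 / 2 + 1 : ℂ) = 1 / 2 by norm_num, Complex.Gamma_one_half_eq_sqrt] at h
  linear_combination 2 * h

lemma one_half_add_natCast_ne_zero (k : ℕ) : (1 / 2 : ℂ) + k ≠ 0 := by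
  have : (0 : ℝ) < 1 / 2 + k := by positivity
  have h : ((1 / 2 + k : ℝ) : ℂ) ≠ 0 := Complex.ofReal_ne_zero.2 this.ne'
  push_cast at h
  exact h

/-- The part even in z is `e1`, the odd part `e2`. Working with 1/Γ keeps the argument valid at the
poles of Γ. -/
lemma hermiteFunction_add_one (τ z : ℂ) :
    hermiteFunction (τ + 1) z =
      2 * z * hermiteFunction τ z - 2 * τ * hermiteFunction (τ - 1) z := by
  have e1 := kummerF_add_one_left_sub one_half_add_natCast_ne_zero (-(τ + 1) / 2) (z ^ 2)
  have e2 := mul_kummerF_eq one_half_add_natCast_ne_zero (-τ / 2) (z ^ 2)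
  have g1 := Complex.one_div_Gamma_eq_self_mul_one_div_Gamma_add_one (-τ / 2)
  have g2 := Complex.one_div_Gamma_eq_self_mul_one_div_Gamma_add_one (-(τ + 1) / 2)
  have p1 : (2 : ℂ) ^ (τ + 1) = 4 * 2 ^ (τ - 1) := by
    rw [show τ + 1 = (τ - 1) + 2 by ring, Complex.cpow_add _ _ two_ne_zero]; norm_num; ring
  have p2 : (2 : ℂ) ^ τ = 2 * 2 ^ (τ - 1) := by
    nth_rw 1 [show τ = (τ - 1) + 1 by ring]
    rw [Complex.cpow_add _ _ two_ne_zero]; norm_num; ring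
  simp only [hermiteFunction, Complex.Gamma_one_half_eq_sqrt, Complex.Gamma_neg_one_half_eq, p1, p2]
  rw [show (-(τ + 1) / 2 + 1 : ℂ) = (1 - τ) / 2 by ring, show (1 / 2 + 1 : ℂ) = 3 / 2 by norm_num]
    at *
  rw [show (1 - (τ + 1)) / 2 = -τ / 2 by ring, show -(τ - 1) / 2 = (1 - τ) / 2 by ring,
    show (1 - (τ - 1)) / 2 = -τ / 2 + 1 by ring]
  simp only [div_eq_mul_inv _ (Complex.Gamma _)]
  rw [g2, g1]
  linear_combination (-4 * 2 ^ (τ - 1) * (Real.sqrt Real.pi : ℂ) *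
    (-τ / 2 * (Complex.Gamma (-τ / 2 + 1))⁻¹)) * e1 + (-8 * 2 ^ (τ - 1) * z * (Real.sqrt Real.pi : ℂ) *
    (Complex.Gamma ((1 - τ) / 2))⁻¹) * e2

/-! ### The double integral in w = x + t -/

open MeasureTheory Set

lemma integral_cpow_mul_exp_neg_sq {s : ℂ} (hs : 0 < s.re) :
    ∫ t in Ioi (0 : ℝ), (t : ℂ) ^ (s - 1) * (Real.exp (-t ^ 2) : ℂ) =
      Complex.Gamma (s / 2) / 2 := by
  have h := mellin_comp_rpow (fun t : ℝ => (Real.exp (-t) : ℂ)) s 2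
  have hs2 : 0 < (s / 2).re := by simpa using hs
  simp only [mellin, smul_eq_mul, Real.rpow_two] at h
  rw [h, Complex.Gamma_eq_integral hs2, Complex.GammaIntegral]
  simp only [abs_two, Complex.real_smul]
  push_cast
  simp only [mul_comm]
  ring

lemma integrableOn_cpow_mul_exp_neg {s : ℂ} (hs : 0 < s.re) :
    IntegrableOn (fun x : ℝ => (x : ℂ) ^ (s - 1) * (Real.exp (-x) : ℂ)) (Ioi 0) := by
  simpa [mul_comm] using Complex.GammaIntegral_convergent hs

/-- Writing the Gaussian as e^{-x}e^{-t} times a bounded function of x+t reduces integrability to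
that of two Gamma integrands. -/
lemma gaussian_shear_eq (s p : ℂ) (x t : ℝ) :
    (x : ℂ) ^ (s - 1) * (Real.exp (-x) : ℂ) * ((t : ℂ) ^ (p - 1) * (Real.exp (-t) : ℂ)) *
        (Real.exp ((x + t) - (x + t) ^ 2) : ℂ) =
      (x : ℂ) ^ (s - 1) * ((t : ℂ) ^ (p - 1) * (Real.exp (-(x + t) ^ 2) : ℂ)) := by
  have : Real.exp (-(x + t) ^ 2) =
      Real.exp (-x) * Real.exp (-t) * Real.exp ((x + t) - (x + t) ^ 2) := by
    rw [← Real.exp_add, ← Real.exp_add]; ring_nf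
  rw [this]; push_cast; ring

lemma integrable_and_integral_cpow_mul_gaussian_shear {s p : ℂ} (hs : 0 < s.re) (hp : 0 < p.re) :
    IntegrableOn (fun x : ℝ => (x : ℂ) ^ (s - 1) *
      ∫ t in Ioi (0 : ℝ), (t : ℂ) ^ (p - 1) * (Real.exp (-(x + t) ^ 2) : ℂ)) (Ioi 0) ∧
    ∫ x in Ioi (0 : ℝ), (x : ℂ) ^ (s - 1) *
      ∫ t in Ioi (0 : ℝ), (t : ℂ) ^ (p - 1) * (Real.exp (-(x + t) ^ 2) : ℂ) =
      Complex.betaIntegral s p * (Complex.Gamma ((s + p) / 2) / 2) := by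
  set f : ℝ → ℂ := (Ioi 0).indicator fun x : ℝ => (x : ℂ) ^ (s - 1) * (Real.exp (-x) : ℂ) with hf
  set g : ℝ → ℂ := (Ioi 0).indicator fun x : ℝ => (x : ℂ) ^ (p - 1) * (Real.exp (-x) : ℂ) with hg
  set W : ℝ → ℂ := fun w => (Real.exp (w - w ^ 2) : ℂ) with hW
  have fi : Integrable f :=
    (integrable_indicator_iff measurableSet_Ioi).2 (integrableOn_cpow_mul_exp_neg hs)
  have gi : Integrable g :=
    (integrable_indicator_iff measurableSet_Ioi).2 (integrableOn_cpow_mul_exp_neg hp)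
  have Wc : Continuous W := by fun_prop
  have Wb (w : ℝ) : ‖W w‖ ≤ Real.exp 1 := by
    rw [hW, Complex.norm_real, Real.norm_eq_abs, Real.abs_exp, Real.exp_le_exp]
    nlinarith [sq_nonneg (w - 1 / 2)]
  have K1 : Integrable (fun q : ℝ × ℝ => f q.1 * g q.2 * W (q.1 + q.2))
      (volume.prod volume) :=
    (fi.mul_prod gi).mul_bdd (c := Real.exp 1)
      (Wc.comp (continuous_fst.add continuous_snd)).aestronglyMeasurable
      (Filter.Eventually.of_forall fun q => Wb _)
  have K2 : Integrable (fun q : ℝ × ℝ => f q.2 * g (q.1 - q.2) * W q.1)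
      (volume.prod volume) :=
    (fi.convolution_integrand (ContinuousLinearMap.mul ℂ ℂ) gi).mul_bdd (c := Real.exp 1)
      (Wc.comp continuous_fst).aestronglyMeasurable (Filter.Eventually.of_forall fun q => Wb _)
  have inner1 (x : ℝ) : ∫ t, f x * g t * W (x + t) = (Ioi (0 : ℝ)).indicator
      (fun x : ℝ => (x : ℂ) ^ (s - 1) *
        ∫ t in Ioi (0 : ℝ), (t : ℂ) ^ (p - 1) * (Real.exp (-(x + t) ^ 2) : ℂ)) x := by
    by_cases hx : x ∈ Ioi (0 : ℝ)
    · rw [indicator_of_mem hx, ← integral_const_mul, ← integral_indicator measurableSet_Ioi]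
      refine integral_congr_ae (Filter.Eventually.of_forall fun t => ?_)
      by_cases ht : t ∈ Ioi (0 : ℝ)
      · simp only [hf, hg, hW, indicator_of_mem hx, indicator_of_mem ht]
        exact gaussian_shear_eq s p x t
      · simp [hg, indicator_of_notMem ht]
    · simp [hf, indicator_of_notMem hx]
  -- For fixed w the integrand lives on 0 < x < w, a scaled beta integral.
  have inner2 (w : ℝ) : ∫ x, f x * g (w - x) * W w = (Ioi (0 : ℝ)).indicator
      (fun w : ℝ => Complex.betaIntegral s p *
        ((w : ℂ) ^ (s + p - 1) * (Real.exp (-w ^ 2) : ℂ))) w := by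
    by_cases hw : w ∈ Ioi (0 : ℝ)
    · have hw' : 0 < w := hw
      rw [indicator_of_mem hw, mul_left_comm, ← mul_assoc, ← Complex.betaIntegral_scaled s p hw',
        intervalIntegral.integral_of_le hw'.le, integral_Ioc_eq_integral_Ioo, ← integral_mul_const,
        ← integral_indicator measurableSet_Ioo]
      refine integral_congr_ae (Filter.Eventually.of_forall fun x => ?_)
      by_cases hx : x ∈ Ioo 0 w
      · have h1 : x ∈ Ioi (0 : ℝ) := hx.1
        have h2 : w - x ∈ Ioi (0 : ℝ) := sub_pos.2 hx.2
        have := gaussian_shear_eq s p x (w - x)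
        simp only [add_sub_cancel, Complex.ofReal_sub w x] at this
        simp only [hf, hg, hW, indicator_of_mem h1, indicator_of_mem h2, indicator_of_mem hx]
        rw [Complex.ofReal_sub w x, this, mul_assoc]
      · rw [indicator_of_notMem hx]
        by_cases h1 : 0 < x
        · have h2 : w - x ∉ Ioi (0 : ℝ) := fun h => hx ⟨h1, sub_pos.1 h⟩
          simp [hg, indicator_of_notMem h2]
        · simp [hf, indicator_of_notMem (show x ∉ Ioi (0 : ℝ) from h1)]
    · rw [indicator_of_notMem hw]
      refine integral_eq_zero_of_ae (Filter.Eventually.of_forall fun x => ?_)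
      by_cases h1 : 0 < x
      · have h2 : w - x ∉ Ioi (0 : ℝ) := fun h => hw (h1.trans (sub_pos.1 h))
        simp [hg, indicator_of_notMem h2]
      · simp [hf, indicator_of_notMem (show x ∉ Ioi (0 : ℝ) from h1)]
  have sp : 0 < (s + p).re := by simpa using add_pos hs hp
  refine ⟨?_, ?_⟩
  · rw [← integrable_indicator_iff measurableSet_Ioi]
    exact K1.integral_prod_left.congr (Filter.Eventually.of_forall inner1)
  · rw [← integral_indicator measurableSet_Ioi, ← funext inner1]
    have shift (x : ℝ) : ∫ t, f x * g t * W (x + t) = ∫ w, f x * g (w - x) * W w := by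
      rw [← integral_sub_right_eq_self (fun t => f x * g t * W (x + t)) x]
      simp
    simp_rw [shift]
    rw [← integral_integral_swap (f := fun w x => f x * g (w - x) * W w) K2]
    simp_rw [inner2]
    rw [integral_indicator measurableSet_Ioi, integral_const_mul, integral_cpow_mul_exp_neg_sq sp]

/-! ### Integral representation for Re τ < 0 -/

lemma integrableOn_rpow_mul_exp_linear_sub_sq {q : ℝ} (hq : 0 < q) (c : ℝ) :
    IntegrableOn (fun t : ℝ => t ^ (q - 1) * Real.exp (c * t - t ^ 2)) (Ioi 0) := by
  have h := (integrableOn_rpow_mul_exp_neg_mul_sq (b := 1 / 2) (by norm_num)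
    (show -1 < q - 1 by linarith)).const_mul (Real.exp (c ^ 2 / 2))
  refine h.mono' (by fun_prop) ?_
  filter_upwards [ae_restrict_mem measurableSet_Ioi] with t ht
  have ht' : 0 < t := ht
  rw [Real.norm_eq_abs, abs_of_nonneg (by positivity), mul_left_comm, ← Real.exp_add]
  gcongr
  -- ct - t² ≤ c²/2 - t²/2.
  nlinarith [sq_nonneg (c - t)]

lemma hasSum_integral_cpow_mul_exp_linear_sub_sq {p : ℂ} (hp : 0 < p.re) (x : ℝ) :
    HasSum (fun k : ℕ => (-2 * x : ℂ) ^ k / k.factorial * (Complex.Gamma ((k + p) / 2) / 2))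
      (∫ t in Ioi (0 : ℝ), (t : ℂ) ^ (p - 1) * (Real.exp (-2 * x * t - t ^ 2) : ℂ)) := by
  have expand (y : ℝ) : HasSum (fun k : ℕ => y ^ k / k.factorial) (Real.exp y) := by
    rw [Real.exp_eq_exp_ℝ]; exact NormedSpace.expSeries_div_hasSum_exp y
  have key := hasSum_integral_of_dominated_convergence (μ := volume.restrict (Ioi (0 : ℝ)))
    (F := fun (k : ℕ) (t : ℝ) => (t : ℂ) ^ (p - 1) * (Real.exp (-t ^ 2) : ℂ) *
      (((-2 * x * t) ^ k / k.factorial : ℝ) : ℂ))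
    (f := fun t : ℝ => (t : ℂ) ^ (p - 1) * (Real.exp (-2 * x * t - t ^ 2) : ℂ))
    (fun k t => t ^ (p.re - 1) * Real.exp (-t ^ 2) * ((2 * |x| * t) ^ k / k.factorial))
    (fun k => by fun_prop) ?_ ?_ ?_ ?_
  · refine key.congr_fun fun k => ?_
    have hkp : 0 < ((k : ℂ) + p).re := by simp; positivity
    rw [← integral_cpow_mul_exp_neg_sq hkp, ← integral_const_mul]
    refine setIntegral_congr_fun measurableSet_Ioi fun t ht => ?_
    have ht' : (t : ℂ) ≠ 0 := Complex.ofReal_ne_zero.2 (ne_of_gt ht)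
    rw [add_sub_assoc, Complex.cpow_add _ _ ht', Complex.cpow_natCast]
    push_cast
    rw [mul_pow]
    ring
  · intro k
    filter_upwards [ae_restrict_mem measurableSet_Ioi] with t ht
    have ht' : 0 < t := ht
    rw [norm_mul, norm_mul, Complex.norm_cpow_eq_rpow_re_of_pos ht', Complex.norm_real,
      Complex.norm_real, norm_div, norm_pow]
    simp [abs_of_pos ht']
  · filter_upwards with t
    exact ((expand (2 * |x| * t)).mul_left _).summable
  · refine (integrableOn_rpow_mul_exp_linear_sub_sq hp (2 * |x|)).congr_fun (fun t ht => ?_)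
      measurableSet_Ioi
    simp only
    rw [((expand (2 * |x| * t)).mul_left _).tsum_eq, mul_assoc (t ^ (p.re - 1)), ← Real.exp_add,
      sub_eq_neg_add (2 * |x| * t)]
  · filter_upwards with t
    have := ((Complex.hasSum_ofReal.2 (expand (-2 * x * t))).mul_left
      ((t : ℂ) ^ (p - 1) * (Real.exp (-t ^ 2) : ℂ)))
    rwa [mul_assoc ((t : ℂ) ^ (p - 1)), ← Complex.ofReal_mul, ← Real.exp_add,
      show -t ^ 2 + -2 * x * t = -2 * x * t - t ^ 2 by ring] at this

lemma Complex.Gamma_add_natCast_of_re_pos {z : ℂ} (hz : 0 < z.re) (k : ℕ) :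
    Complex.Gamma (z + k) = (ascPochhammer ℂ k).eval z * Complex.Gamma z := by
  induction k with
  | zero => simp
  | succ k ih =>
    have : z + k ≠ 0 := fun h => by
      have := congrArg Complex.re h
      simp at this
      linarith [(Nat.cast_nonneg k : (0 : ℝ) ≤ k)]
    rw [Nat.cast_succ, ← add_assoc, Complex.Gamma_add_one _ this, ih, ascPochhammer_succ_eval]
    ring

lemma factorial_two_mul_eq (k : ℕ) :
    ((2 * k).factorial : ℂ) = 4 ^ k * k.factorial * (ascPochhammer ℂ k).eval (1 / 2) := by
  induction k with
  | zero => simp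
  | succ k ih =>
    rw [show 2 * (k + 1) = 2 * k + 1 + 1 by ring, Nat.factorial_succ, Nat.factorial_succ,
      Nat.factorial_succ, ascPochhammer_succ_eval]
    push_cast
    rw [ih]
    ring

lemma factorial_two_mul_add_one_eq (k : ℕ) :
    ((2 * k + 1).factorial : ℂ) = 4 ^ k * k.factorial * (ascPochhammer ℂ k).eval (3 / 2) := by
  induction k with
  | zero => simp
  | succ k ih =>
    rw [show 2 * (k + 1) + 1 = (2 * k + 1) + 1 + 1 by ring, Nat.factorial_succ (2 * k + 1 + 1),
      Nat.factorial_succ (2 * k + 1), Nat.factorial_succ k, ascPochhammer_succ_eval]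
    push_cast
    rw [ih]
    ring

/-- Expanding e^{-2xt} and integrating termwise, the even and odd powers of x each form a Kummer
series. -/
lemma integral_cpow_mul_exp_linear_sub_sq_eq_kummerF {p : ℂ} (hp : 0 < p.re) (x : ℝ) :
    ∫ t in Ioi (0 : ℝ), (t : ℂ) ^ (p - 1) * (Real.exp (-2 * x * t - t ^ 2) : ℂ) =
      Complex.Gamma (p / 2) / 2 * kummerF (p / 2) (1 / 2) ((x : ℂ) ^ 2) -
        x * Complex.Gamma ((1 + p) / 2) * kummerF ((1 + p) / 2) (3 / 2) ((x : ℂ) ^ 2) := by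
  refine (hasSum_integral_cpow_mul_exp_linear_sub_sq hp x).unique ?_
  have hp0 : 0 < (p / 2).re := by simpa using hp
  have hp1 : 0 < ((1 + p) / 2).re := by simp; positivity
  rw [sub_eq_add_neg]
  refine HasSum.even_add_odd ?_ ?_
  · refine ((hasSum_kummerF _ _ _).mul_left _).congr_fun fun k => ?_
    rw [show (((2 * k : ℕ) : ℂ) + p) / 2 = p / 2 + k by push_cast; ring,
      Complex.Gamma_add_natCast_of_re_pos hp0, factorial_two_mul_eq, kummerTerm, pow_mul, mul_pow,
      mul_pow, div_mul_eq_mul_div, div_mul_eq_mul_div]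
    norm_num
    field_simp
  · rw [← neg_mul]
    refine ((hasSum_kummerF _ _ _).mul_left _).congr_fun fun k => ?_
    rw [show (((2 * k + 1 : ℕ) : ℂ) + p) / 2 = (1 + p) / 2 + k by push_cast; ring,
      Complex.Gamma_add_natCast_of_re_pos hp1, factorial_two_mul_add_one_eq, kummerTerm,
      pow_succ, pow_mul, mul_pow, mul_pow]
    norm_num
    field_simp

lemma Gamma_neg_mul_hermiteFunction {τ : ℂ} (hτ : τ.re < 0) (x : ℝ) :
    Complex.Gamma (-τ) * hermiteFunction τ x =
      ∫ t in Ioi (0 : ℝ), (t : ℂ) ^ (-τ - 1) * (Real.exp (-2 * x * t - t ^ 2) : ℂ) := by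
  have hp : 0 < (-τ).re := by simpa using hτ
  rw [integral_cpow_mul_exp_linear_sub_sq_eq_kummerF hp, hermiteFunction,
    Complex.Gamma_one_half_eq_sqrt, Complex.Gamma_neg_one_half_eq]
  have dup := Complex.Gamma_mul_Gamma_add_half (-τ / 2)
  have g0 : Complex.Gamma (-τ / 2) ≠ 0 := Complex.Gamma_ne_zero_of_re_pos (by simpa using hτ)
  have g1 : Complex.Gamma ((1 - τ) / 2) ≠ 0 :=
    Complex.Gamma_ne_zero_of_re_pos (by simp; linarith)
  rw [show -τ / 2 + 1 / 2 = (1 - τ) / 2 by ring, show 2 * (-τ / 2) = -τ by ring] at dup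
  have two' : (2 : ℂ) ^ (1 - -τ) = 2 * 2 ^ τ := by
    rw [show 1 - -τ = 1 + τ by ring, Complex.cpow_add _ _ two_ne_zero]; norm_num
  rw [two'] at dup
  rw [show (1 + -τ) = 1 - τ by ring]
  generalize Complex.Gamma (-τ / 2) = A at *
  have e0 : Complex.Gamma (-τ) * (2 ^ τ * (Real.sqrt Real.pi / Complex.Gamma ((1 - τ) / 2))) =
      A / 2 := by
    field_simp
    linear_combination -dup
  have e1 : Complex.Gamma (-τ) * (2 ^ τ * (-2 * Real.sqrt Real.pi / A)) =
      -Complex.Gamma ((1 - τ) / 2) := by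
    field_simp
    linear_combination dup
  linear_combination kummerF (-τ / 2) (1 / 2) ((x : ℂ) ^ 2) * e0 +
    x * kummerF ((1 - τ) / 2) (3 / 2) ((x : ℂ) ^ 2) * e1

lemma hermiteFunction_mul_exp_of_re_neg {τ : ℂ} (hτ : τ.re < 0) (x : ℝ) :
    hermiteFunction τ x * (Real.exp (-x ^ 2) : ℂ) = (Complex.Gamma (-τ))⁻¹ *
      ∫ t in Ioi (0 : ℝ), (t : ℂ) ^ (-τ - 1) * (Real.exp (-(x + t) ^ 2) : ℂ) := by
  have g : Complex.Gamma (-τ) ≠ 0 := Complex.Gamma_ne_zero_of_re_pos (by simpa using hτ)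
  rw [eq_inv_mul_iff_mul_eq₀ g, ← mul_assoc, Gamma_neg_mul_hermiteFunction hτ,
    ← integral_mul_const]
  refine integral_congr_ae (Filter.Eventually.of_forall fun t => ?_)
  simp only
  rw [mul_assoc, ← Complex.ofReal_mul, ← Real.exp_add]
  ring_nf

/-! ### The Mellin transform for all τ -/

/-- The Mellin transform of `H_τ(x) exp(-x²)` converges at `s` and has its closed-form value. -/
def HermiteMellin (τ s : ℂ) : Prop :=
  IntegrableOn (fun x : ℝ => (x : ℂ) ^ (s - 1) * hermiteFunction τ x * (Real.exp (-x ^ 2) : ℂ))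
    (Ioi 0) ∧
  ∫ x in Ioi (0 : ℝ), (x : ℂ) ^ (s - 1) * hermiteFunction τ x * (Real.exp (-x ^ 2) : ℂ) =
    Complex.Gamma s * (Real.sqrt Real.pi * 2 ^ (τ - s)) * (Complex.Gamma ((s - τ + 1) / 2))⁻¹

lemma hermiteMellin_of_re_neg {τ s : ℂ} (hτ : τ.re < 0) (hs : 0 < s.re) : HermiteMellin τ s := by
  have hp : 0 < (-τ).re := by simpa using hτ
  obtain ⟨h1, h2⟩ := integrable_and_integral_cpow_mul_gaussian_shear hs hp
  have e (x : ℝ) : (x : ℂ) ^ (s - 1) * hermiteFunction τ x * (Real.exp (-x ^ 2) : ℂ) =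
      (Complex.Gamma (-τ))⁻¹ * ((x : ℂ) ^ (s - 1) *
        ∫ t in Ioi (0 : ℝ), (t : ℂ) ^ (-τ - 1) * (Real.exp (-(x + t) ^ 2) : ℂ)) := by
    rw [mul_assoc, hermiteFunction_mul_exp_of_re_neg hτ, mul_left_comm]
  unfold HermiteMellin
  simp_rw [e]
  refine ⟨h1.const_mul _, ?_⟩
  rw [integral_const_mul, h2, Complex.betaIntegral_eq_Gamma_mul_div _ _ hs hp]
  have dup := Complex.Gamma_mul_Gamma_add_half ((s + -τ) / 2)
  rw [show (s + -τ) / 2 + 1 / 2 = (s - τ + 1) / 2 by ring,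
    show 2 * ((s + -τ) / 2) = s + -τ by ring,
    show 1 - (s + -τ) = (τ - s) + 1 by ring, Complex.cpow_add _ _ two_ne_zero,
    Complex.cpow_one] at dup
  have g0 : Complex.Gamma (-τ) ≠ 0 := Complex.Gamma_ne_zero_of_re_pos hp
  have g1 : Complex.Gamma (s + -τ) ≠ 0 :=
    Complex.Gamma_ne_zero_of_re_pos (by simp at hp ⊢; linarith)
  have g2 : Complex.Gamma ((s - τ + 1) / 2) ≠ 0 :=
    Complex.Gamma_ne_zero_of_re_pos (by simp at hp ⊢; linarith)
  generalize Complex.Gamma (s + -τ) = A at *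
  generalize Complex.Gamma (-τ) = B at *
  generalize Complex.Gamma ((s + -τ) / 2) = C at *
  generalize Complex.Gamma ((s - τ + 1) / 2) = D at *
  generalize (2 : ℂ) ^ (τ - s) = E at *
  field_simp
  linear_combination Complex.Gamma s * dup

/-- The factor x in the recurrence shifts s to s+1. Both closed forms then share 1/Γ((s-τ)/2+1), and
the remaining factor s-τ lowers that argument by one. -/
lemma HermiteMellin.add_one {τ s : ℂ} (hs : 0 < s.re) (h0 : HermiteMellin (τ - 1) s)
    (h1 : HermiteMellin τ (s + 1)) : HermiteMellin (τ + 1) s := by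
  obtain ⟨i0, v0⟩ := h0
  obtain ⟨i1, v1⟩ := h1
  have e : EqOn (fun x : ℝ =>
      2 * ((x : ℂ) ^ (s + 1 - 1) * hermiteFunction τ x * (Real.exp (-x ^ 2) : ℂ)) -
        2 * τ * ((x : ℂ) ^ (s - 1) * hermiteFunction (τ - 1) x * (Real.exp (-x ^ 2) : ℂ)))
      (fun x : ℝ =>
        (x : ℂ) ^ (s - 1) * hermiteFunction (τ + 1) x * (Real.exp (-x ^ 2) : ℂ)) (Ioi 0) := by
    intro x hx
    have hx' : (x : ℂ) ≠ 0 := Complex.ofReal_ne_zero.2 (ne_of_gt hx)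
    simp only
    rw [hermiteFunction_add_one, show s + 1 - 1 = (s - 1) + 1 by ring, Complex.cpow_add _ _ hx',
      Complex.cpow_one]
    ring
  refine ⟨IntegrableOn.congr_fun ((i1.const_mul 2).sub (i0.const_mul (2 * τ))) e
    measurableSet_Ioi, ?_⟩
  rw [← setIntegral_congr_fun measurableSet_Ioi e,
    integral_sub (i1.const_mul 2) (i0.const_mul (2 * τ)), integral_const_mul, integral_const_mul,
    v0, v1]
  have hs0 : s ≠ 0 := fun h => by simp [h] at hs
  have g := Complex.one_div_Gamma_eq_self_mul_one_div_Gamma_add_one ((s - τ) / 2)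
  rw [Complex.Gamma_add_one s hs0, show (s + 1 - τ + 1) / 2 = (s - τ) / 2 + 1 by ring,
    show (s - (τ - 1) + 1) / 2 = (s - τ) / 2 + 1 by ring,
    show (s - (τ + 1) + 1) / 2 = (s - τ) / 2 by ring, g,
    show τ - (s + 1) = τ - 1 - s by ring, show τ + 1 - s = (τ - 1 - s) + 2 by ring,
    Complex.cpow_add _ _ two_ne_zero, Complex.cpow_ofNat]
  ring

lemma hermiteMellin_of_re_lt_natCast (N : ℕ) :
    ∀ τ s : ℂ, τ.re < N → 0 < s.re → HermiteMellin τ s := by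
  induction N with
  | zero => intro τ s hτ hs; exact hermiteMellin_of_re_neg (by simpa using hτ) hs
  | succ N ih =>
    intro τ s hτ hs
    push_cast at hτ
    have := HermiteMellin.add_one hs (τ := τ - 1)
      (ih (τ - 1 - 1) s (by simp; linarith) hs)
      (ih (τ - 1) (s + 1) (by simp; linarith) (by simp; linarith))
    rwa [sub_add_cancel] at this

lemma hermiteMellin (τ : ℂ) {s : ℂ} (hs : 0 < s.re) : HermiteMellin τ s :=
  let ⟨N, hN⟩ := exists_nat_gt τ.re
  hermiteMellin_of_re_lt_natCast N τ s hN hs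

/-! ### Moments on the half-line and the line -/

lemma integrable_and_integral_of_even {f : ℝ → ℂ} (hf : ∀ x, f (-x) = f x)
    (hi : IntegrableOn f (Ioi 0)) :
    Integrable f ∧ ∫ x, f x = 2 * ∫ x in Ioi (0 : ℝ), f x := by
  have hi' : IntegrableOn f (Iic 0) := by
    have h := IntegrableOn.comp_neg_Iio (c := (0 : ℝ)) (f := f) (by simpa using hi)
    rw [integrableOn_Iic_iff_integrableOn_Iio]
    simpa only [hf] using h
  have hv : ∫ x in Iic (0 : ℝ), f x = ∫ x in Ioi (0 : ℝ), f x := by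
    simpa only [hf, neg_zero] using integral_comp_neg_Iic (0 : ℝ) f
  refine ⟨?_, ?_⟩
  · rw [← integrableOn_univ, ← Iic_union_Ioi (a := (0 : ℝ))]
    exact hi'.union hi
  · rw [← intervalIntegral.integral_Iic_add_Ioi hi' hi, hv, two_mul]

lemma hermiteFunction_moment {τ : ℂ} (hτ : -1 < τ.re) (n : ℕ) :
    IntegrableOn (fun x : ℝ => (x : ℂ) ^ (2 * (n : ℂ) + τ) * hermiteFunction τ (x : ℂ) *
        (Real.exp (-x ^ 2) : ℂ)) (Ioi 0) ∧
    ∫ x in Ioi (0 : ℝ), (x : ℂ) ^ (2 * (n : ℂ) + τ) * hermiteFunction τ (x : ℂ) *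
        (Real.exp (-x ^ 2) : ℂ) =
      ((Real.sqrt Real.pi : ℝ) : ℂ) / 2 ^ (2 * n + 1) *
        (Complex.Gamma (2 * (n : ℂ) + τ + 1) / (n.factorial : ℂ)) := by
  have hs : 0 < (2 * (n : ℂ) + τ + 1).re := by
    have : (0 : ℝ) ≤ n := Nat.cast_nonneg n
    simp
    linarith
  obtain ⟨h1, h2⟩ := hermiteMellin τ hs
  rw [add_sub_cancel_right] at h1 h2
  refine ⟨h1, h2.trans ?_⟩
  rw [show (2 * (n : ℂ) + τ + 1 - τ + 1) / 2 = n + 1 by ring, Complex.Gamma_nat_eq_factorial,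
    show τ - (2 * (n : ℂ) + τ + 1) = -((2 * n + 1 : ℕ) : ℂ) by push_cast; ring, Complex.cpow_neg,
    Complex.cpow_natCast]
  ring

lemma hermiteFunction_abs_moment {τ : ℂ} (hτ : -1 < τ.re) (n : ℕ) :
    Integrable (fun x : ℝ => (x : ℂ) ^ (2 * n) * ((|x| : ℝ) : ℂ) ^ τ *
        hermiteFunction τ ((|x| : ℝ) : ℂ) * (Real.exp (-x ^ 2) : ℂ)) ∧
    ∫ x : ℝ, (x : ℂ) ^ (2 * n) * ((|x| : ℝ) : ℂ) ^ τ *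
        hermiteFunction τ ((|x| : ℝ) : ℂ) * (Real.exp (-x ^ 2) : ℂ) =
      ((Real.sqrt Real.pi : ℝ) : ℂ) / 2 ^ (2 * n) *
        (Complex.Gamma (2 * (n : ℂ) + τ + 1) / (n.factorial : ℂ)) := by
  obtain ⟨h1, h2⟩ := hermiteFunction_moment hτ n
  have e : EqOn (fun x : ℝ => (x : ℂ) ^ (2 * (n : ℂ) + τ) * hermiteFunction τ (x : ℂ) *
        (Real.exp (-x ^ 2) : ℂ))
      (fun x : ℝ => (x : ℂ) ^ (2 * n) * ((|x| : ℝ) : ℂ) ^ τ *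
        hermiteFunction τ ((|x| : ℝ) : ℂ) * (Real.exp (-x ^ 2) : ℂ)) (Ioi 0) := by
    intro x hx
    have hx' : (x : ℂ) ≠ 0 := Complex.ofReal_ne_zero.2 (ne_of_gt hx)
    simp only
    rw [abs_of_pos hx, Complex.cpow_add _ _ hx', show 2 * (n : ℂ) = ((2 * n : ℕ) : ℂ) by simp,
      Complex.cpow_natCast]
  obtain ⟨h3, h4⟩ := integrable_and_integral_of_even
    (fun x => by simp) (h1.congr_fun e measurableSet_Ioi)
  refine ⟨h3, ?_⟩
  rw [h4, ← setIntegral_congr_fun measurableSet_Ioi e, h2, pow_succ]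
  field_simp

theorem mainTheorem3 (τ : ℂ) (hτ : -1 < τ.re) :
    (∀ n : ℕ,
      MeasureTheory.IntegrableOn
        (fun x : ℝ => (x : ℂ) ^ (2 * (n : ℂ) + τ) * hermiteFunction τ (x : ℂ) *
          (Real.exp (-x ^ 2) : ℂ)) (Set.Ioi 0) ∧
      ∫ x in Set.Ioi (0 : ℝ), (x : ℂ) ^ (2 * (n : ℂ) + τ) * hermiteFunction τ (x : ℂ) *
          (Real.exp (-x ^ 2) : ℂ) =
        ((Real.sqrt Real.pi : ℝ) : ℂ) / 2 ^ (2 * n + 1) *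
          (Complex.Gamma (2 * (n : ℂ) + τ + 1) / (n.factorial : ℂ))) ∧
    (∀ n : ℕ,
      MeasureTheory.Integrable
        (fun x : ℝ => (x : ℂ) ^ (2 * n) * ((|x| : ℝ) : ℂ) ^ τ *
          hermiteFunction τ ((|x| : ℝ) : ℂ) * (Real.exp (-x ^ 2) : ℂ)) ∧
      ∫ x : ℝ, (x : ℂ) ^ (2 * n) * ((|x| : ℝ) : ℂ) ^ τ *
          hermiteFunction τ ((|x| : ℝ) : ℂ) * (Real.exp (-x ^ 2) : ℂ) =
        ((Real.sqrt Real.pi : ℝ) : ℂ) / 2 ^ (2 * n) *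
          (Complex.Gamma (2 * (n : ℂ) + τ + 1) / (n.factorial : ℂ))) ∧
    Complex.Gamma (τ + 1) =
      2 / ((Real.sqrt Real.pi : ℝ) : ℂ) *
        ∫ x in Set.Ioi (0 : ℝ), (x : ℂ) ^ τ * hermiteFunction τ (x : ℂ) *
          (Real.exp (-x ^ 2) : ℂ) ∧
    Complex.Gamma (τ + 1) =
      1 / ((Real.sqrt Real.pi : ℝ) : ℂ) *
        ∫ x : ℝ, ((|x| : ℝ) : ℂ) ^ τ * hermiteFunction τ ((|x| : ℝ) : ℂ) *
          (Real.exp (-x ^ 2) : ℂ) := by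
  have hpi : ((Real.sqrt Real.pi : ℝ) : ℂ) ≠ 0 :=
    Complex.ofReal_ne_zero.2 (Real.sqrt_ne_zero'.2 Real.pi_pos)
  refine ⟨hermiteFunction_moment hτ, hermiteFunction_abs_moment hτ, ?_, ?_⟩
  · have h := (hermiteFunction_moment hτ 0).2
    simp only [Nat.cast_zero, mul_zero, zero_add, pow_one, Nat.factorial_zero, Nat.cast_one,
      div_one] at h
    rw [h]
    field_simp
  · have h := (hermiteFunction_abs_moment hτ 0).2
    simp only [Nat.cast_zero, mul_zero, zero_add, pow_zero, Nat.factorial_zero, Nat.cast_one,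
      div_one, one_mul] at h
    rw [h]
    field_simp
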